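/- Let $\mathcal H$ be a real Hilbert space, $t_0\ge 0$ and $\lambda>0$. Let $\mu:[t_0,+\infty)\to(0,+\infty)$ be continuously differentiable and nondecreasing, let $\gamma:[t_0,+\infty)\to(0,+\infty)$ be continuous, and let $V:\mathcal H\to\mathcal H$ be $L$-Lipschitz continuous for some $L\ge 0$. Consider the Cauchy problem $$\ddot y(t)+\lambda\dot y(t)+\mu(t)\frac{d}{dt}V(y(t))+\gamma(t)V(y(t))=0,\qquad y(t_0)=y_0,\quad \dot y(t_0)=y_1. \qquad (\ast)$$ A function $y:[t_0,+\infty)\to\mathcal H$ is called a strong global solution of $(\ast)$ if (i) $y$ is differentiable on $[t_0,+\infty)$ (one-sidedly at $t_0$), and $y$ and $\dot y$ are locally absolutely continuous, that is, absolutely continuous on each interval $[t_0,t_1]$ with $t_1\ge t_0$; (ii) for almost every $t\in[t_0,+\infty)$ the derivatives $\ddot y(t)$ and $\frac{d}{dt}V(y(t))$ exist and the differential equation in $(\ast)$ holds at $t$; (iii) $y(t_0)=y_0$ and $\dot y(t_0)=y_1$. Then, for each $(y_0,y_1)\in\mathcal H\times\mathcal H$, the Cauchy problem $(\ast)$ has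 a unique strong global solution $y:[t_0,+\infty)\to\mathcal H$. -/

import Mathlib

open Set MeasureTheory
open scoped NNReal

/-- `f` is locally absolutely continuous on `[t₀, +∞)`, that is, absolutely continuous on each
compact interval `[t₀, t₁]`. Only the values of `f` on `[t₀, +∞)` matter. -/
def LocallyAbsolutelyContinuousFrom {H : Type*} [NormedAddCommGroup H]
    (f : ℝ → H) (t₀ : ℝ) : Prop :=
  ∀ t₁ : ℝ, t₀ ≤ t₁ → AbsolutelyContinuousOnInterval f t₀ t₁

/-- `y : [t₀, +∞) → H` is a strong global solution of the Cauchy problem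
`y'' + lam y' + μ(t) (d/dt) V(y(t)) + γ(t) V(y(t)) = 0`, `y(t₀) = y₀`, `y'(t₀) = y₁`.

A function on `[t₀, +∞)` is represented by a function on `ℝ` whose values outside `[t₀, +∞)` are
irrelevant: all derivatives are taken within `[t₀, +∞)` (one-sided at `t₀`). -/
structure IsStrongGlobalSolution {H : Type*} [NormedAddCommGroup H] [NormedSpace ℝ H]
    (t₀ lam : ℝ) (μ γ : ℝ → ℝ) (V : H → H) (y₀ y₁ : H) (y : ℝ → H) : Prop where
  /-- `y` is locally absolutely continuous. -/
  locAbsCont : LocallyAbsolutelyContinuousFrom y t₀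
  /-- The derivative of `y` exists on `[t₀, +∞)`. -/
  differentiableOn : DifferentiableOn ℝ y (Ici t₀)
  /-- The derivative of `y` is locally absolutely continuous. -/
  locAbsCont_deriv : LocallyAbsolutelyContinuousFrom (derivWithin y (Ici t₀)) t₀
  /-- For almost every `t ≥ t₀` the derivatives in the equation exist and the equation holds. -/
  equation : ∀ᵐ t ∂(volume.restrict (Ici t₀)),
    DifferentiableWithinAt ℝ (derivWithin y (Ici t₀)) (Ici t₀) t ∧
    DifferentiableWithinAt ℝ (fun s => V (y s)) (Ici t₀) t ∧
    derivWithin (derivWithin y (Ici t₀)) (Ici t₀) t + lam • derivWithin y (Ici t₀) t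
      + μ t • derivWithin (fun s => V (y s)) (Ici t₀) t + γ t • V (y t) = 0
  /-- Initial position. -/
  initial_pos : y t₀ = y₀
  /-- Initial velocity. -/
  initial_vel : derivWithin y (Ici t₀) t₀ = y₁

/-!
In the variables `y` and `w = y' + μ V(y)` the equation becomes the first order system
`y' = w - μ V(y)`, `w' = (μ' - γ) V(y) - lam (w - μ V(y))`, in which `V(y)` is no longer
differentiated. Its right-hand side is continuous in `t` and Lipschitz in `(y, w)` with a constant
depending continuously on `t`, so it has a unique global `C¹` solution: the Picard operator
contracts a weighted supremum norm.

If `(y, w)` solves the system, then `V(y)` is merely locally Lipschitz, but Lipschitz curves in a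
uniformly convex Banach space are differentiable almost everywhere, so the second order equation
holds almost everywhere. Conversely, for a strong solution `y` the curve `w` is locally absolutely
continuous and its derivative agrees almost everywhere with a continuous function; hence `w` is
`C¹` and `(y, w)` solves the system everywhere, which gives uniqueness.
-/

open Filter Function Topology TopologicalSpace
open scoped BoundedContinuousFunction

section LipschitzCurve

variable {E : Type*} [NormedAddCommGroup E] [NormedSpace ℝ E]

theorem exists_forall_norm_sub_lt_of_norm_le_add [UniformConvexSpace E] {m ε : ℝ} (hm : 0 ≤ m)
    (hε : 0 < ε) :
    ∃ η > 0, ∀ x y : E, ‖x‖ ≤ m + η → ‖y‖ ≤ m + η → 2 * (m - η) ≤ ‖x + y‖ → ‖x - y‖ < ε := by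
  obtain ⟨δ, hδ, hconv⟩ :=
    exists_forall_closed_ball_dist_add_le_two_mul_sub E (show 0 < ε / 2 by positivity) m
  obtain ⟨η, hη, hηlt⟩ := exists_between (show 0 < min (ε / 4) (δ / 4) by positivity)
  obtain ⟨hηε, hηδ⟩ := lt_min_iff.1 hηlt
  refine ⟨η, hη, fun x y hx hy hxy => ?_⟩
  let c := m / (m + η)
  have hmη : 0 < m + η := by positivity
  have hball (z : E) (hz : ‖z‖ ≤ m + η) : ‖c • z‖ ≤ m := by
    calc ‖c • z‖ = m * (‖z‖ / (m + η)) := by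
          rw [norm_smul, Real.norm_of_nonneg (by positivity)]; ring
      _ ≤ m := mul_le_of_le_one_right hm ((div_le_one hmη).2 hz)
  have hclose (z : E) (hz : ‖z‖ ≤ m + η) : ‖z - c • z‖ ≤ η := by
    calc ‖z - c • z‖ = ‖(η / (m + η)) • z‖ := by
          congr 1
          rw [show η / (m + η) = 1 - c by simp only [c]; field_simp; ring]
          module
      _ = η * (‖z‖ / (m + η)) := by
          rw [norm_smul, Real.norm_of_nonneg (by positivity)]; ring
      _ ≤ η := mul_le_of_le_one_right hη.le ((div_le_one hmη).2 hz)
  have hadd : 2 * m - δ < ‖c • x + c • y‖ := by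
    have h := norm_add₃_le (a := c • x + c • y) (b := x - c • x) (c := y - c • y)
    rw [show c • x + c • y + (x - c • x) + (y - c • y) = x + y by abel] at h
    linarith [hclose x hx, hclose y hy]
  have hsub : ‖c • x - c • y‖ < ε / 2 :=
    lt_of_not_ge fun h => hadd.not_ge (hconv (hball x hx) (hball y hy) h)
  have h := norm_add₃_le (a := c • x - c • y) (b := x - c • x) (c := -(y - c • y))
  rw [show c • x - c • y + (x - c • x) + -(y - c • y) = x - y by abel, norm_neg] at h
  linarith [hclose x hx, hclose y hy]

theorem cauchy_map_of_forall_exists_dual [UniformConvexSpace E] {ι : Type*} {l : Filter ι}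
    [l.NeBot] {x : ι → E} {m : ℝ} (hle : ∀ ε > 0, ∀ᶠ i in l, ‖x i‖ ≤ m + ε)
    (hge : ∀ ε > 0, ∃ φ : StrongDual ℝ E, ‖φ‖ ≤ 1 ∧ ∀ᶠ i in l, m - ε ≤ φ (x i)) :
    Cauchy (map x l) := by
  have hm : 0 ≤ m := le_of_forall_pos_le_add fun ε hε =>
    let ⟨_, hi⟩ := (hle ε hε).exists
    (norm_nonneg _).trans hi
  refine Metric.cauchy_iff.2 ⟨inferInstance, fun ε hε => ?_⟩
  obtain ⟨η, hη, hclose⟩ := exists_forall_norm_sub_lt_of_norm_le_add (E := E) hm hε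
  obtain ⟨φ, hφ, hφx⟩ := hge η hη
  refine ⟨_, image_mem_map ((hle η hη).and hφx), ?_⟩
  rintro _ ⟨i, ⟨hi, hφi⟩, rfl⟩ _ ⟨j, ⟨hj, hφj⟩, rfl⟩
  rw [dist_eq_norm]
  refine hclose _ _ hi hj ?_
  calc 2 * (m - η) ≤ φ (x i + x j) := by rw [map_add]; linarith
    _ ≤ ‖φ (x i + x j)‖ := le_abs_self _
    _ ≤ ‖x i + x j‖ := by simpa only [one_mul] using φ.le_of_opNorm_le hφ (x i + x j)

theorem norm_slope_le_slope {f : ℝ → E} {M : ℝ → ℝ}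
    (hfM : ∀ a b, a ≤ b → ‖f b - f a‖ ≤ M b - M a) (a b : ℝ) : ‖slope f a b‖ ≤ slope M a b := by
  wlog hab : a ≤ b generalizing a b
  · rw [slope_comm f, slope_comm M]
    exact this b a (le_of_not_ge hab)
  rw [slope_def_module, slope_def_field, norm_smul, norm_inv,
    Real.norm_of_nonneg (sub_nonneg.2 hab), div_eq_inv_mul]
  exact mul_le_mul_of_nonneg_left (hfM a b hab) (inv_nonneg.2 (sub_nonneg.2 hab))

theorem differentiableAt_of_norm_sub_le [UniformConvexSpace E] [CompleteSpace E] {f : ℝ → E}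
    {M : ℝ → ℝ} {m t : ℝ} (hfM : ∀ a b, a ≤ b → ‖f b - f a‖ ≤ M b - M a) (hM : HasDerivAt M m t)
    (hdual : ∀ ε > 0, ∃ φ : StrongDual ℝ E, ‖φ‖ ≤ 1 ∧
      DifferentiableAt ℝ (fun s => φ (f s)) t ∧ m - ε < deriv (fun s => φ (f s)) t) :
    DifferentiableAt ℝ f t := by
  have hcauchy : Cauchy (map (slope f t) (𝓝[≠] t)) := by
    refine cauchy_map_of_forall_exists_dual (m := m) (fun ε hε => ?_) fun ε hε => ?_
    · filter_upwards [(hasDerivAt_iff_tendsto_slope.1 hM).eventually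
        (gt_mem_nhds (lt_add_of_pos_right m hε))] with s hs
      exact (norm_slope_le_slope hfM t s).trans hs.le
    · obtain ⟨φ, hφ, hdiff, hlt⟩ := hdual ε hε
      refine ⟨φ, hφ, ?_⟩
      filter_upwards [(hasDerivAt_iff_tendsto_slope.1 hdiff.hasDerivAt).eventually
        (lt_mem_nhds hlt)] with s hs
      simpa only [slope_def_module, map_smul, map_sub] using hs.le
  obtain ⟨f', hf'⟩ := CompleteSpace.complete hcauchy
  exact (hasDerivAt_iff_tendsto_slope.2 hf').differentiableAt

theorem exists_seq_dual_isLUB_norm {A : Set E} (hA : IsSeparable A) :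
    ∃ φ : ℕ → StrongDual ℝ E, (∀ n, ‖φ n‖ ≤ 1) ∧
      ∀ x ∈ A, IsLUB (range fun n => φ n x) ‖x‖ := by
  obtain ⟨c, hc, hAc⟩ := hA
  obtain ⟨d, hd⟩ := (hc.insert 0).exists_eq_range (insert_nonempty 0 c)
  choose φ hφ hφd using fun n => exists_dual_vector'' ℝ (d n)
  have hle (n : ℕ) (z : E) : φ n z ≤ ‖z‖ := by
    simpa using (le_abs_self _).trans ((φ n).le_of_opNorm_le (hφ n) z)
  refine ⟨φ, hφ, fun x hx => ⟨by rintro _ ⟨n, rfl⟩; exact hle n x, fun b hb => ?_⟩⟩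
  refine le_of_forall_pos_le_add fun ε hε => ?_
  have hxd : x ∈ closure (range d) := hd ▸ closure_mono (subset_insert 0 c) (hAc hx)
  obtain ⟨_, ⟨n, rfl⟩, hn⟩ := Metric.mem_closure_iff.1 hxd (ε / 2) (half_pos hε)
  rw [dist_eq_norm] at hn
  have hφsub := hle n (d n - x)
  rw [map_sub, show φ n (d n) = ‖d n‖ from hφd n, norm_sub_rev] at hφsub
  linarith [hb (mem_range_self n), norm_le_norm_add_norm_sub' x (d n)]

section iSupDeriv

variable {ι : Type*} {C : ℝ≥0} {g : ι → ℝ → ℝ}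

theorem bddAbove_range_deriv_of_lipschitzWith (hg : ∀ i, LipschitzWith C (g i)) (t : ℝ) :
    BddAbove (range fun i => deriv (g i) t) :=
  ⟨C, by
    rintro _ ⟨i, rfl⟩
    exact (le_abs_self _).trans (norm_deriv_le_of_lipschitz (hg i))⟩

theorem locallyIntegrable_iSup_deriv_of_lipschitzWith [Countable ι] [Nonempty ι]
    (hg : ∀ i, LipschitzWith C (g i)) : LocallyIntegrable (fun t => ⨆ i, deriv (g i) t) volume := by
  have hmeas : Measurable fun t => ⨆ i, deriv (g i) t := .iSup fun i => measurable_deriv (g i)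
  refine (locallyIntegrable_const (C : ℝ)).mono hmeas.aestronglyMeasurable (.of_forall fun t => ?_)
  have hderiv (i : ι) := abs_le.1 (norm_deriv_le_of_lipschitz (x₀ := t) (hg i))
  rw [Real.norm_eq_abs, NNReal.norm_eq, abs_le]
  exact ⟨(hderiv (Classical.arbitrary ι)).1.trans
    (le_ciSup (bddAbove_range_deriv_of_lipschitzWith hg t) _), ciSup_le fun i => (hderiv i).2⟩

end iSupDeriv

theorem norm_sub_le_integral_of_isLUB_dual {ι : Type*} {φ : ι → StrongDual ℝ E} {C : ℝ≥0}
    {f : ℝ → E} (hf : LipschitzWith C f) {m : ℝ → ℝ} {a b : ℝ} (hab : a ≤ b)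
    (hφ : IsLUB (range fun i => φ i (f b - f a)) ‖f b - f a‖) (hm : IntervalIntegrable m volume a b)
    (hderiv : ∀ i t, deriv (fun s => φ i (f s)) t ≤ m t) : ‖f b - f a‖ ≤ ∫ t in a..b, m t := by
  refine hφ.2 ?_
  rintro _ ⟨i, rfl⟩
  have hAC : AbsolutelyContinuousOnInterval (fun s => φ i (f s)) a b :=
    ((φ i).lipschitz.comp hf).lipschitzOnWith.absolutelyContinuousOnInterval
  calc φ i (f b - f a) = ∫ t in a..b, deriv (fun s => φ i (f s)) t := by
        rw [hAC.integral_deriv_eq_sub, map_sub]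
    _ ≤ ∫ t in a..b, m t := intervalIntegral.integral_mono_on hab hAC.intervalIntegrable_deriv hm
        fun t _ => hderiv i t

-- The speed `‖f'‖` is recovered almost everywhere as the supremum of the derivatives of countably
-- many scalar curves `φ n ∘ f`, which exist by Lebesgue's theorem.
theorem ae_differentiableAt_of_lipschitzWith [UniformConvexSpace E] [CompleteSpace E] {C : ℝ≥0}
    {f : ℝ → E} (hf : LipschitzWith C f) : ∀ᵐ t, DifferentiableAt ℝ f t := by
  have hsep : IsSeparable (range fun p : ℝ × ℝ => f p.1 - f p.2) :=
    isSeparable_range (by have := hf.continuous; fun_prop)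
  obtain ⟨φ, hφ, hnorm⟩ := exists_seq_dual_isLUB_norm hsep
  have hφf (n : ℕ) : LipschitzWith C fun s => φ n (f s) :=
    ((φ n).lipschitz.comp hf).weaken (mul_le_of_le_one_left zero_le (hφ n))
  let speed (t : ℝ) : ℝ := ⨆ n, deriv (fun s => φ n (f s)) t
  have hspeed : LocallyIntegrable speed volume := locallyIntegrable_iSup_deriv_of_lipschitzWith hφf
  have hint (a b : ℝ) : IntervalIntegrable speed volume a b :=
    (hspeed.integrableOn_isCompact isCompact_uIcc).intervalIntegrable
  filter_upwards [ae_all_iff.2 fun n => (hφf n).ae_differentiableAt_real,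
    LocallyIntegrable.ae_hasDerivAt_integral hspeed] with t hdiff hderiv
  refine differentiableAt_of_norm_sub_le (M := fun s => ∫ r in (0 : ℝ)..s, speed r)
    (fun a b hab => ?_) (hderiv 0) fun ε hε => ?_
  · rw [intervalIntegral.integral_interval_sub_left (hint _ _) (hint _ _)]
    exact norm_sub_le_integral_of_isLUB_dual hf hab (hnorm _ ⟨(b, a), rfl⟩) (hint a b) fun n s =>
      le_ciSup (bddAbove_range_deriv_of_lipschitzWith hφf s) n
  · obtain ⟨n, hn⟩ := exists_lt_of_lt_ciSup (sub_lt_self (speed t) hε)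
    exact ⟨φ n, hφ n, hdiff n, hn⟩

theorem ae_differentiableAt_of_lipschitzOnWith_Icc [UniformConvexSpace E] [CompleteSpace E]
    {C : ℝ≥0} {f : ℝ → E} {a b : ℝ} (hab : a ≤ b) (hf : LipschitzOnWith C f (Icc a b)) :
    ∀ᵐ t, t ∈ Ioo a b → DifferentiableAt ℝ f t := by
  have hext : LipschitzWith (C * 1) (IccExtend hab ((Icc a b).domRestrict f)) :=
    hf.to_restrict.comp (LipschitzWith.projIcc hab)
  filter_upwards [ae_differentiableAt_of_lipschitzWith hext] with t ht htab
  refine ht.congr_of_eventuallyEq ?_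
  filter_upwards [isOpen_Ioo.mem_nhds htab] with s hs
  exact (IccExtend_of_mem hab ((Icc a b).domRestrict f) (Ioo_subset_Icc_self hs)).symm

theorem ae_restrict_Ici_differentiableAt_of_locallyLipschitzOn [UniformConvexSpace E]
    [CompleteSpace E] {f : ℝ → E} {a : ℝ} (hf : LocallyLipschitzOn (Ici a) f) :
    ∀ᵐ t ∂volume.restrict (Ici a), DifferentiableAt ℝ f t := by
  have hIoo (n : ℕ) : ∀ᵐ t, t ∈ Ioo a (a + n) → DifferentiableAt ℝ f t := by
    have hsub : Icc a (a + n) ⊆ Ici a := Icc_subset_Ici_self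
    obtain ⟨C, hC⟩ := (hf.mono hsub).exists_lipschitzOnWith_of_compact isCompact_Icc
    exact ae_differentiableAt_of_lipschitzOnWith_Icc (by simp) hC
  rw [← restrict_Ioi_eq_restrict_Ici, ae_restrict_iff' measurableSet_Ioi]
  filter_upwards [ae_all_iff.2 hIoo] with t ht hat
  obtain ⟨n, hn⟩ := exists_nat_gt (t - a)
  exact ht n ⟨hat, by linarith⟩

end LipschitzCurve

section Bielecki

variable {E : Type*} [NormedAddCommGroup E] [NormedSpace ℝ E] {f : ℝ → E → E} {κ : ℝ → ℝ≥0}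
  {t₀ : ℝ}

/-- The weight of the Bielecki norm `sup ‖u t‖ / bieleckiWeight κ t₀ t`, in which the Picard
operator of a vector field with Lipschitz constants `κ t` is a contraction on the whole real line.
The hyperbolic cosine takes the place of the customary exponential in order to treat both time
directions at once. -/
noncomputable def bieleckiWeight (κ : ℝ → ℝ≥0) (t₀ t : ℝ) : ℝ :=
  Real.cosh (2 * ∫ s in t₀..t, (κ s : ℝ))

theorem one_le_bieleckiWeight (t : ℝ) : 1 ≤ bieleckiWeight κ t₀ t :=
  Real.one_le_cosh _

theorem bieleckiWeight_pos (t : ℝ) : 0 < bieleckiWeight κ t₀ t :=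
  Real.cosh_pos _

theorem hasDerivAt_two_mul_integral (hκ : Continuous κ) (t : ℝ) :
    HasDerivAt (fun t => 2 * ∫ s in t₀..t, (κ s : ℝ)) (2 * κ t) t :=
  ((NNReal.continuous_coe.comp hκ).integral_hasStrictDerivAt t₀ t).hasDerivAt.const_mul 2

theorem continuous_bieleckiWeight (hκ : Continuous κ) : Continuous (bieleckiWeight κ t₀) :=
  Real.continuous_cosh.comp
    (continuous_iff_continuousAt.2 fun t => (hasDerivAt_two_mul_integral hκ t).continuousAt)

theorem continuous_mul_bieleckiWeight (hκ : Continuous κ) :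
    Continuous fun s => κ s * bieleckiWeight κ t₀ s :=
  (NNReal.continuous_coe.comp hκ).mul (continuous_bieleckiWeight hκ)

theorem integral_mul_bieleckiWeight (hκ : Continuous κ) (t : ℝ) :
    ∫ s in t₀..t, κ s * bieleckiWeight κ t₀ s = Real.sinh (2 * ∫ s in t₀..t, (κ s : ℝ)) / 2 := by
  have hderiv (s : ℝ) : HasDerivAt (fun s => Real.sinh (2 * ∫ r in t₀..s, (κ r : ℝ)) / 2)
      (κ s * bieleckiWeight κ t₀ s) s :=
    ((hasDerivAt_two_mul_integral hκ s).sinh.div_const 2).congr_deriv (by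
      rw [bieleckiWeight]; ring)
  rw [intervalIntegral.integral_eq_sub_of_hasDerivAt (fun s _ => hderiv s)
    ((continuous_mul_bieleckiWeight hκ).intervalIntegrable _ _)]
  simp

theorem norm_integral_le_mul_bieleckiWeight (hκ : Continuous κ) {h : ℝ → E} {c : ℝ} (hc : 0 ≤ c)
    (hh : ∀ s, ‖h s‖ ≤ c * (κ s * bieleckiWeight κ t₀ s)) (t : ℝ) :
    ‖∫ s in t₀..t, h s‖ ≤ c / 2 * bieleckiWeight κ t₀ t := by
  calc ‖∫ s in t₀..t, h s‖ ≤ |∫ s in t₀..t, c * (κ s * bieleckiWeight κ t₀ s)| :=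
        intervalIntegral.norm_integral_le_abs_of_norm_le (.of_forall hh)
          ((continuous_const.mul (continuous_mul_bieleckiWeight hκ)).intervalIntegrable _ _)
    _ = c / 2 * |Real.sinh (2 * ∫ s in t₀..t, (κ s : ℝ))| := by
        rw [intervalIntegral.integral_const_mul, integral_mul_bieleckiWeight hκ, abs_mul, abs_div,
          abs_of_nonneg hc, abs_two]
        ring
    _ ≤ c / 2 * bieleckiWeight κ t₀ t := by
        gcongr
        rw [Real.abs_sinh, bieleckiWeight, ← Real.cosh_abs]
        exact (Real.sinh_lt_cosh _).le

theorem norm_picard_bieleckiWeight_smul_le (hκ : Continuous κ) (hf₀ : ∀ t, ‖f t 0‖ ≤ κ t)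
    (hlip : ∀ t, LipschitzWith (κ t) (f t)) (x₀ : E) (v : ℝ →ᵇ E) (t : ℝ) :
    ‖ODE.picard f t₀ x₀ (fun s => bieleckiWeight κ t₀ s • v s) t‖ ≤
      (‖x₀‖ + (1 + ‖v‖) / 2) * bieleckiWeight κ t₀ t := by
  have hfield (s : ℝ) : ‖f s (bieleckiWeight κ t₀ s • v s)‖ ≤
      (1 + ‖v‖) * (κ s * bieleckiWeight κ t₀ s) := by
    calc ‖f s (bieleckiWeight κ t₀ s • v s)‖
        ≤ ‖f s 0‖ + ‖f s (bieleckiWeight κ t₀ s • v s) - f s 0‖ := norm_le_norm_add_norm_sub' _ _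
      _ ≤ κ s + κ s * ‖bieleckiWeight κ t₀ s • v s - 0‖ :=
          add_le_add (hf₀ s) ((hlip s).norm_sub_le _ _)
      _ = κ s * 1 + κ s * (bieleckiWeight κ t₀ s * ‖v s‖) := by
          rw [sub_zero, norm_smul, Real.norm_of_nonneg (bieleckiWeight_pos s).le, mul_one]
      _ ≤ κ s * bieleckiWeight κ t₀ s + κ s * (bieleckiWeight κ t₀ s * ‖v‖) := by
          gcongr
          · exact one_le_bieleckiWeight s
          · exact (bieleckiWeight_pos s).le
          · exact v.norm_coe_le_norm s
      _ = (1 + ‖v‖) * (κ s * bieleckiWeight κ t₀ s) := by ring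
  calc ‖ODE.picard f t₀ x₀ (fun s => bieleckiWeight κ t₀ s • v s) t‖
      ≤ ‖x₀‖ + (1 + ‖v‖) / 2 * bieleckiWeight κ t₀ t :=
        norm_add_le_of_le le_rfl (norm_integral_le_mul_bieleckiWeight hκ (by positivity) hfield t)
    _ ≤ ‖x₀‖ * bieleckiWeight κ t₀ t + (1 + ‖v‖) / 2 * bieleckiWeight κ t₀ t := by
        gcongr
        exact le_mul_of_one_le_right (norm_nonneg _) (one_le_bieleckiWeight t)
    _ = (‖x₀‖ + (1 + ‖v‖) / 2) * bieleckiWeight κ t₀ t := by ring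

theorem continuous_apply_bieleckiWeight_smul (hf : Continuous (uncurry f)) (hκ : Continuous κ)
    (v : ℝ →ᵇ E) : Continuous fun s => f s (bieleckiWeight κ t₀ s • v s) :=
  hf.comp (continuous_id.prodMk ((continuous_bieleckiWeight hκ).smul v.continuous))

theorem norm_picard_bieleckiWeight_smul_sub_le (hf : Continuous (uncurry f)) (hκ : Continuous κ)
    (hlip : ∀ t, LipschitzWith (κ t) (f t)) (x₀ : E) (v w : ℝ →ᵇ E) (t : ℝ) :
    ‖ODE.picard f t₀ x₀ (fun s => bieleckiWeight κ t₀ s • v s) t -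
      ODE.picard f t₀ x₀ (fun s => bieleckiWeight κ t₀ s • w s) t‖ ≤
      dist v w / 2 * bieleckiWeight κ t₀ t := by
  have hint (v : ℝ →ᵇ E) : IntervalIntegrable (fun s => f s (bieleckiWeight κ t₀ s • v s))
      volume t₀ t := (continuous_apply_bieleckiWeight_smul hf hκ v).intervalIntegrable _ _
  rw [ODE.picard_apply, ODE.picard_apply, add_sub_add_left_eq_sub,
    ← intervalIntegral.integral_sub (hint v) (hint w)]
  refine norm_integral_le_mul_bieleckiWeight hκ dist_nonneg (fun s => ?_) t
  calc ‖f s (bieleckiWeight κ t₀ s • v s) - f s (bieleckiWeight κ t₀ s • w s)‖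
      ≤ κ s * ‖bieleckiWeight κ t₀ s • v s - bieleckiWeight κ t₀ s • w s‖ :=
        (hlip s).norm_sub_le _ _
    _ = κ s * bieleckiWeight κ t₀ s * dist (v s) (w s) := by
        rw [← smul_sub, norm_smul, Real.norm_of_nonneg (bieleckiWeight_pos s).le, dist_eq_norm,
          mul_assoc]
    _ ≤ κ s * bieleckiWeight κ t₀ s * dist v w := by
        gcongr
        · exact mul_nonneg (κ s).2 (bieleckiWeight_pos s).le
        · exact BoundedContinuousFunction.dist_coe_le_dist s
    _ = dist v w * (κ s * bieleckiWeight κ t₀ s) := mul_comm _ _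

theorem norm_inv_smul_le_of_le_mul {w c : ℝ} {x : E} (hw : 0 < w) (hx : ‖x‖ ≤ c * w) :
    ‖w⁻¹ • x‖ ≤ c := by
  rw [norm_smul, norm_inv, Real.norm_of_nonneg hw.le, inv_mul_eq_div]
  exact (div_le_iff₀ hw).2 hx

theorem exists_contractingWith_bieleckiWeight_smul_eq_picard (hf : Continuous (uncurry f))
    (hκ : Continuous κ) (hf₀ : ∀ t, ‖f t 0‖ ≤ κ t) (hlip : ∀ t, LipschitzWith (κ t) (f t))
    (t₀ : ℝ) (x₀ : E) :
    ∃ Φ : (ℝ →ᵇ E) → (ℝ →ᵇ E), ContractingWith (1 / 2) Φ ∧ ∀ v t,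
      bieleckiWeight κ t₀ t • Φ v t =
        ODE.picard f t₀ x₀ (fun s => bieleckiWeight κ t₀ s • v s) t := by
  have hcont (v : ℝ →ᵇ E) : Continuous fun t => (bieleckiWeight κ t₀ t)⁻¹ •
      ODE.picard f t₀ x₀ (fun s => bieleckiWeight κ t₀ s • v s) t :=
    ((continuous_bieleckiWeight hκ).inv₀ fun t => (bieleckiWeight_pos t).ne').smul <|
      continuous_const.add <| intervalIntegral.continuous_primitive
        (fun _ _ => (continuous_apply_bieleckiWeight_smul hf hκ v).intervalIntegrable _ _) t₀
  let Φ (v : ℝ →ᵇ E) : ℝ →ᵇ E := .ofNormedAddCommGroup _ (hcont v) _ fun t =>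
    norm_inv_smul_le_of_le_mul (bieleckiWeight_pos t)
      (norm_picard_bieleckiWeight_smul_le hκ hf₀ hlip x₀ v t)
  refine ⟨Φ, ⟨by norm_num, LipschitzWith.of_dist_le_mul fun v w => ?_⟩, fun v t =>
    smul_inv_smul₀ (bieleckiWeight_pos t).ne' _⟩
  refine (BoundedContinuousFunction.dist_le (by positivity)).2 fun t => ?_
  have hsub : Φ v t - Φ w t = (bieleckiWeight κ t₀ t)⁻¹ •
      (ODE.picard f t₀ x₀ (fun s => bieleckiWeight κ t₀ s • v s) t -
        ODE.picard f t₀ x₀ (fun s => bieleckiWeight κ t₀ s • w s) t) := (smul_sub _ _ _).symm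
  rw [dist_eq_norm, hsub, NNReal.coe_div, NNReal.coe_one, NNReal.coe_two, one_div_mul_eq_div]
  exact norm_inv_smul_le_of_le_mul (bieleckiWeight_pos t)
    (norm_picard_bieleckiWeight_smul_sub_le hf hκ hlip x₀ v w t)

end Bielecki

section IntegralCurve

variable {E : Type*} [NormedAddCommGroup E] [NormedSpace ℝ E] {f : ℝ → E → E} {k : ℝ → ℝ≥0}
  {t₀ : ℝ}

theorem exists_isIntegralCurve_of_lipschitzWith [CompleteSpace E] (hf : Continuous (uncurry f))
    (hk : Continuous k) (hlip : ∀ t, LipschitzWith (k t) (f t)) (t₀ : ℝ) (x₀ : E) :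
    ∃ u : ℝ → E, u t₀ = x₀ ∧ IsIntegralCurve u f := by
  let κ (t : ℝ) : ℝ≥0 := k t + ‖f t 0‖₊
  have hκ : Continuous κ := hk.add (hf.comp (continuous_id.prodMk continuous_const)).nnnorm
  obtain ⟨Φ, hΦ, hΦf⟩ := exists_contractingWith_bieleckiWeight_smul_eq_picard hf hκ
    (fun t => by simp [κ])
    (fun t => (hlip t).weaken (le_add_of_nonneg_right zero_le)) t₀ x₀
  let v : ℝ →ᵇ E := hΦ.fixedPoint Φ
  let u (t : ℝ) : E := bieleckiWeight κ t₀ t • v t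
  have hu (t : ℝ) : u t = ODE.picard f t₀ x₀ u t := by
    rw [← hΦf v t, hΦ.fixedPoint_isFixedPt]
  refine ⟨u, by rw [hu, ODE.picard_apply₀], fun t => ?_⟩
  have hfu : Continuous fun s => f s (u s) := continuous_apply_bieleckiWeight_smul hf hκ v
  exact ((hfu.integral_hasStrictDerivAt t₀ t).hasDerivAt.const_add x₀).congr_of_eventuallyEq
    (.of_forall hu)

theorem exists_isIntegralCurveOn_Ici_of_lipschitzWith [CompleteSpace E]
    (hf : ContinuousOn (uncurry f) (Ici t₀ ×ˢ univ)) (hk : ContinuousOn k (Ici t₀))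
    (hlip : ∀ t ∈ Ici t₀, LipschitzWith (k t) (f t)) (x₀ : E) :
    ∃ u : ℝ → E, u t₀ = x₀ ∧ IsIntegralCurveOn u f (Ici t₀) := by
  have hclamp : Continuous fun t => max t t₀ := continuous_id.max continuous_const
  obtain ⟨u, hu₀, hu⟩ := exists_isIntegralCurve_of_lipschitzWith
    (f := fun t => f (max t t₀)) (k := fun t => k (max t t₀))
    (hf.comp_continuous ((hclamp.comp continuous_fst).prodMk continuous_snd)
      fun p => ⟨le_max_right p.1 t₀, mem_univ _⟩)
    (hk.comp_continuous hclamp fun t => le_max_right t t₀)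
    (fun t => hlip _ (le_max_right t t₀)) t₀ x₀
  refine ⟨u, hu₀, fun t ht => ?_⟩
  simpa only [max_eq_left (mem_Ici.1 ht)] using (hu t).hasDerivWithinAt (s := Ici t₀)

theorem eqOn_Ici_of_isIntegralCurveOn_of_lipschitzWith (hk : ContinuousOn k (Ici t₀))
    (hlip : ∀ t ∈ Ici t₀, LipschitzWith (k t) (f t)) {u v : ℝ → E}
    (hu : IsIntegralCurveOn u f (Ici t₀)) (hv : IsIntegralCurveOn v f (Ici t₀))
    (h₀ : u t₀ = v t₀) : EqOn u v (Ici t₀) := by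
  intro T hT
  have hsub : Icc t₀ T ⊆ Ici t₀ := Icc_subset_Ici_self
  obtain ⟨K, hK⟩ := (isCompact_Icc.image_of_continuousOn (hk.mono hsub)).bddAbove
  have hlipK (t : ℝ) (ht : t ∈ Ico t₀ T) : LipschitzOnWith K (f t) univ :=
    ((hlip t ht.1).weaken (hK (mem_image_of_mem k (Ico_subset_Icc_self ht)))).lipschitzOnWith
  refine ODE_solution_unique_of_mem_Icc_right hlipK (hu.continuousOn.mono hsub)
    (fun t ht => (hu t ht.1).mono (Ici_subset_Ici.2 ht.1)) (fun _ _ => mem_univ _)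
    (hv.continuousOn.mono hsub) (fun t ht => (hv t ht.1).mono (Ici_subset_Ici.2 ht.1))
    (fun _ _ => mem_univ _) h₀ ⟨hT, le_rfl⟩

theorem contDiffOn_one_of_isIntegralCurveOn_Ici (hf : ContinuousOn (uncurry f) (Ici t₀ ×ˢ univ))
    {u : ℝ → E} (hu : IsIntegralCurveOn u f (Ici t₀)) : ContDiffOn ℝ 1 u (Ici t₀) := by
  refine (contDiffOn_one_iff_derivWithin (uniqueDiffOn_Ici t₀)).2
    ⟨fun t ht => (hu t ht).differentiableWithinAt, ?_⟩
  have hfu : ContinuousOn (fun t => f t (u t)) (Ici t₀) :=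
    hf.comp (continuousOn_id.prodMk hu.continuousOn) fun t ht => ⟨ht, mem_univ _⟩
  exact hfu.congr fun t ht => (hu t ht).derivWithin (uniqueDiffOn_Ici t₀ t ht)

end IntegralCurve

namespace LocallyAbsolutelyContinuousFrom

variable {E F : Type*} [NormedAddCommGroup E] [NormedAddCommGroup F] {f g : ℝ → E} {t₀ : ℝ}

theorem congr (hf : LocallyAbsolutelyContinuousFrom f t₀) (h : EqOn g f (Ici t₀)) :
    LocallyAbsolutelyContinuousFrom g t₀ := by
  intro T hT
  have hsub : uIcc t₀ T ⊆ Ici t₀ := uIcc_of_le hT ▸ Icc_subset_Ici_self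
  refine Tendsto.congr' ?_ (hf T hT)
  filter_upwards [mem_inf_of_right (mem_principal_self _)] with I hI
  refine Finset.sum_congr rfl fun i hi => ?_
  rw [h (hsub (hI.1 i hi).1), h (hsub (hI.1 i hi).2)]

theorem continuousOn (hf : LocallyAbsolutelyContinuousFrom f t₀) : ContinuousOn f (Ici t₀) := by
  intro t ht
  have hlt : t < t + 1 := lt_add_one t
  have hmem : Icc t₀ (t + 1) ∈ 𝓝[Ici t₀] t := by
    rw [← Ici_inter_Iic]
    exact inter_mem_nhdsWithin _ (Iic_mem_nhds hlt)
  have hT : t₀ ≤ t + 1 := (mem_Ici.1 ht).trans hlt.le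
  have hcont : ContinuousOn f (Icc t₀ (t + 1)) := uIcc_of_le hT ▸ (hf _ hT).continuousOn
  exact (hcont t ⟨ht, hlt.le⟩).mono_of_mem_nhdsWithin hmem

theorem add (hf : LocallyAbsolutelyContinuousFrom f t₀)
    (hg : LocallyAbsolutelyContinuousFrom g t₀) :
    LocallyAbsolutelyContinuousFrom (fun t => f t + g t) t₀ :=
  fun T hT => (hf T hT).fun_add (hg T hT)

theorem sub (hf : LocallyAbsolutelyContinuousFrom f t₀)
    (hg : LocallyAbsolutelyContinuousFrom g t₀) :
    LocallyAbsolutelyContinuousFrom (fun t => f t - g t) t₀ :=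
  fun T hT => (hf T hT).fun_sub (hg T hT)

theorem smul [NormedSpace ℝ E] {a : ℝ → ℝ} (ha : LocallyAbsolutelyContinuousFrom a t₀)
    (hf : LocallyAbsolutelyContinuousFrom f t₀) :
    LocallyAbsolutelyContinuousFrom (fun t => a t • f t) t₀ :=
  fun T hT => (ha T hT).fun_smul (hf T hT)

theorem lipschitzWith_comp {L : ℝ≥0} {V : E → F} (hV : LipschitzWith L V)
    (hf : LocallyAbsolutelyContinuousFrom f t₀) :
    LocallyAbsolutelyContinuousFrom (fun t => V (f t)) t₀ := by
  intro T hT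
  refine squeeze_zero (fun I => Finset.sum_nonneg fun _ _ => dist_nonneg) (fun I => ?_)
    (by simpa only [mul_zero] using Tendsto.const_mul (L : ℝ) (hf T hT))
  rw [Finset.mul_sum]
  exact Finset.sum_le_sum fun _ _ => hV.dist_le_mul _ _

theorem of_contDiffOn [NormedSpace ℝ E] (hf : ContDiffOn ℝ 1 f (Ici t₀)) :
    LocallyAbsolutelyContinuousFrom f t₀ := by
  intro T hT
  have hsub : uIcc t₀ T ⊆ Ici t₀ := uIcc_of_le hT ▸ Icc_subset_Ici_self
  exact (hf.mono hsub).absolutelyContinuousOnInterval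

end LocallyAbsolutelyContinuousFrom

section ContinuousDerivative

variable {E : Type*} [NormedAddCommGroup E] [NormedSpace ℝ E] {F w : ℝ → E}
  {t₀ : ℝ}

theorem exists_contDiff_forall_hasDerivAt_of_continuousOn_Ici [CompleteSpace E]
    (hF : ContinuousOn F (Ici t₀)) :
    ∃ P : ℝ → E, ContDiff ℝ 1 P ∧ ∀ t ∈ Ici t₀, HasDerivAt P (F t) t := by
  have hclamp : Continuous fun t => F (max t t₀) :=
    hF.comp_continuous (continuous_id.max continuous_const) fun t => le_max_right t t₀
  let P (t : ℝ) : E := ∫ s in t₀..t, F (max s t₀)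
  have hP (t : ℝ) : HasDerivAt P (F (max t t₀)) t :=
    (hclamp.integral_hasStrictDerivAt t₀ t).hasDerivAt
  refine ⟨P, contDiff_one_iff_deriv.2 ⟨fun t => (hP t).differentiableAt, ?_⟩, fun t ht => ?_⟩
  · rwa [funext fun t => (hP t).deriv]
  · simpa only [max_eq_left (mem_Ici.1 ht)] using hP t

theorem LocallyAbsolutelyContinuousFrom.eq_of_ae_hasDerivWithinAt_zero
    (hw : LocallyAbsolutelyContinuousFrom w t₀)
    (h : ∀ᵐ t ∂volume.restrict (Ici t₀), HasDerivWithinAt w 0 (Ici t₀) t) {t : ℝ}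
    (ht : t ∈ Ici t₀) : w t = w t₀ := by
  have hzero : ∀ᵐ s, s ∈ uIcc t₀ t → HasDerivAt w 0 s := by
    rw [ae_restrict_iff' measurableSet_Ici] at h
    filter_upwards [h, Measure.ae_ne volume t₀] with s hs hne hst
    rw [uIcc_of_le ht] at hst
    exact (hs hst.1).hasDerivAt (Ici_mem_nhds (hst.1.lt_of_ne' hne))
  obtain ⟨C, hC⟩ := (hw t ht).const_of_ae_hasDerivAt_zero hzero
  rw [hC t right_mem_uIcc, hC t₀ left_mem_uIcc]

theorem LocallyAbsolutelyContinuousFrom.hasDerivWithinAt_of_ae_hasDerivWithinAt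
    [CompleteSpace E] (hw : LocallyAbsolutelyContinuousFrom w t₀) (hF : ContinuousOn F (Ici t₀))
    (h : ∀ᵐ t ∂volume.restrict (Ici t₀), HasDerivWithinAt w (F t) (Ici t₀) t) {t : ℝ}
    (ht : t ∈ Ici t₀) : HasDerivWithinAt w (F t) (Ici t₀) t := by
  obtain ⟨P, hP, hPF⟩ := exists_contDiff_forall_hasDerivAt_of_continuousOn_Ici hF
  have hdiff : ∀ᵐ s ∂volume.restrict (Ici t₀),
      HasDerivWithinAt (fun s => w s - P s) 0 (Ici t₀) s := by
    filter_upwards [h, ae_restrict_mem measurableSet_Ici] with s hs hst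
    simpa only [sub_self] using hs.fun_sub (hPF s hst).hasDerivWithinAt
  have hconst (s : ℝ) (hs : s ∈ Ici t₀) : w s = P s + (w t₀ - P t₀) := by
    rw [← (hw.sub (.of_contDiffOn hP.contDiffOn)).eq_of_ae_hasDerivWithinAt_zero hdiff hs]
    abel
  exact ((hPF t ht).hasDerivWithinAt.add_const _).congr hconst (hconst t ht)

end ContinuousDerivative

section PhaseSpace

variable {E : Type*} [NormedAddCommGroup E] [NormedSpace ℝ E] {t₀ lam : ℝ} {μ γ : ℝ → ℝ}
  {V : E → E} {L : ℝ≥0} {y₀ y₁ : E} {y : ℝ → E} {u : ℝ → E × E} {t : ℝ}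

/-- The quantity `y' + μ V(y)`, whose derivative absorbs the term `μ (d/dt) V(y)` of the second
order equation. -/
noncomputable def momentum (t₀ : ℝ) (μ : ℝ → ℝ) (V : E → E) (y : ℝ → E) (t : ℝ) : E :=
  derivWithin y (Ici t₀) t + μ t • V (y t)

/-- The time-dependent vector field on phase space whose integral curves are the pairs
`(y, momentum t₀ μ V y)` with `y` a solution of the second order equation. -/
noncomputable def phaseField (t₀ lam : ℝ) (μ γ : ℝ → ℝ) (V : E → E) (t : ℝ) (x : E × E) : E × E :=
  (x.2 - μ t • V x.1,
    (derivWithin μ (Ici t₀) t - γ t) • V x.1 - lam • (x.2 - μ t • V x.1))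

theorem continuousOn_phaseField (hμ : ContDiffOn ℝ 1 μ (Ici t₀)) (hγ : ContinuousOn γ (Ici t₀))
    (hV : Continuous V) :
    ContinuousOn (uncurry (phaseField t₀ lam μ γ V)) (Ici t₀ ×ˢ univ) := by
  have hfst : MapsTo Prod.fst (Ici t₀ ×ˢ (univ : Set (E × E))) (Ici t₀) := fun _ hp => hp.1
  have hμt := hμ.continuousOn.comp continuousOn_fst hfst
  have hμ_deriv :=
    (hμ.continuousOn_derivWithin (uniqueDiffOn_Ici t₀) le_rfl).comp continuousOn_fst hfst
  have hγt := hγ.comp continuousOn_fst hfst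
  have hVx : ContinuousOn (fun p : ℝ × E × E => V p.2.1) (Ici t₀ ×ˢ univ) := by fun_prop
  have hvel : ContinuousOn (fun p : ℝ × E × E => p.2.2 - μ p.1 • V p.2.1) (Ici t₀ ×ˢ univ) :=
    continuousOn_snd.snd.sub (hμt.smul hVx)
  exact hvel.prodMk (((hμ_deriv.sub hγt).smul hVx).sub (hvel.const_smul lam))

theorem lipschitzWith_phaseField (hV : LipschitzWith L V) (t : ℝ) :
    LipschitzWith (max (1 + ‖μ t‖₊ * L)
      (‖derivWithin μ (Ici t₀) t - γ t‖₊ * L + ‖lam‖₊ * (1 + ‖μ t‖₊ * L)))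
      (phaseField t₀ lam μ γ V t) := by
  have hVx (c : ℝ) : LipschitzWith (‖c‖₊ * L) fun x : E × E => c • V x.1 := by
    have := (lipschitzWith_smul c).comp (hV.comp (LipschitzWith.prod_fst (α := E) (β := E)))
    rwa [mul_one] at this
  have hvel : LipschitzWith (1 + ‖μ t‖₊ * L) fun x : E × E => x.2 - μ t • V x.1 :=
    LipschitzWith.prod_snd.sub (hVx (μ t))
  exact hvel.prodMk ((hVx _).sub ((lipschitzWith_smul lam).comp hvel))

theorem exists_continuousOn_lipschitzWith_phaseField (hμ : ContDiffOn ℝ 1 μ (Ici t₀))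
    (hγ : ContinuousOn γ (Ici t₀)) (hV : LipschitzWith L V) :
    ∃ k : ℝ → ℝ≥0, ContinuousOn k (Ici t₀) ∧
      ∀ t, LipschitzWith (k t) (phaseField t₀ lam μ γ V t) := by
  refine ⟨_, ?_, lipschitzWith_phaseField hV⟩
  have hμt := hμ.continuousOn
  have hμ_deriv := hμ.continuousOn_derivWithin (uniqueDiffOn_Ici t₀) le_rfl
  fun_prop

namespace IsStrongGlobalSolution

theorem locallyAbsolutelyContinuousFrom_momentum (hμ : ContDiffOn ℝ 1 μ (Ici t₀))
    (hV : LipschitzWith L V) (hy : IsStrongGlobalSolution t₀ lam μ γ V y₀ y₁ y) :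
    LocallyAbsolutelyContinuousFrom (momentum t₀ μ V y) t₀ :=
  hy.locAbsCont_deriv.add (.smul (.of_contDiffOn hμ) (.lipschitzWith_comp hV hy.locAbsCont))

theorem ae_hasDerivWithinAt_momentum (hμ : ContDiffOn ℝ 1 μ (Ici t₀))
    (hy : IsStrongGlobalSolution t₀ lam μ γ V y₀ y₁ y) :
    ∀ᵐ t ∂volume.restrict (Ici t₀), HasDerivWithinAt (momentum t₀ μ V y)
      (phaseField t₀ lam μ γ V t (y t, momentum t₀ μ V y t)).2 (Ici t₀) t := by
  filter_upwards [hy.equation, ae_restrict_mem measurableSet_Ici] with t ⟨hy'', hVy, heq⟩ ht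
  have hμt := (hμ.differentiableOn one_ne_zero t ht).hasDerivWithinAt
  refine (hy''.hasDerivWithinAt.add (hμt.smul hVy.hasDerivWithinAt)).congr_deriv ?_
  rw [← sub_eq_zero, ← heq, phaseField, momentum]
  module

theorem isIntegralCurveOn_phaseField [CompleteSpace E] (hμ : ContDiffOn ℝ 1 μ (Ici t₀))
    (hγ : ContinuousOn γ (Ici t₀)) (hV : LipschitzWith L V)
    (hy : IsStrongGlobalSolution t₀ lam μ γ V y₀ y₁ y) :
    IsIntegralCurveOn (fun t => (y t, momentum t₀ μ V y t)) (phaseField t₀ lam μ γ V)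
      (Ici t₀) := by
  have hw := hy.locallyAbsolutelyContinuousFrom_momentum hμ hV
  have hfield : ContinuousOn (fun t => phaseField t₀ lam μ γ V t (y t, momentum t₀ μ V y t))
      (Ici t₀) :=
    (continuousOn_phaseField hμ hγ hV.continuous).comp
      (continuousOn_id.prodMk (hy.locAbsCont.continuousOn.prodMk hw.continuousOn))
      fun t ht => ⟨ht, mem_univ _⟩
  intro t ht
  have hvel : HasDerivWithinAt y (phaseField t₀ lam μ γ V t (y t, momentum t₀ μ V y t)).1
      (Ici t₀) t :=
    (hy.differentiableOn t ht).hasDerivWithinAt.congr_deriv (add_sub_cancel_right _ _).symm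
  exact hvel.prodMk
    (hw.hasDerivWithinAt_of_ae_hasDerivWithinAt hfield.snd (hy.ae_hasDerivWithinAt_momentum hμ) ht)

end IsStrongGlobalSolution

theorem hasDerivWithinAt_fst_and_snd_of_isIntegralCurveOn_phaseField
    (hu : IsIntegralCurveOn u (phaseField t₀ lam μ γ V) (Ici t₀)) (ht : t ∈ Ici t₀) :
    HasDerivWithinAt (fun s => (u s).1) (phaseField t₀ lam μ γ V t (u t)).1 (Ici t₀) t ∧
      HasDerivWithinAt (fun s => (u s).2) (phaseField t₀ lam μ γ V t (u t)).2 (Ici t₀) t := by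
  have hut := (hu t ht).hasFDerivWithinAt
  exact ⟨by simpa using hut.fst.hasDerivWithinAt, by simpa using hut.snd.hasDerivWithinAt⟩

theorem eqOn_derivWithin_fst_of_isIntegralCurveOn_phaseField
    (hu : IsIntegralCurveOn u (phaseField t₀ lam μ γ V) (Ici t₀)) :
    EqOn (derivWithin (fun s => (u s).1) (Ici t₀)) (fun t => (u t).2 - μ t • V (u t).1) (Ici t₀) :=
  fun t ht => (hasDerivWithinAt_fst_and_snd_of_isIntegralCurveOn_phaseField hu ht).1.derivWithin
    (uniqueDiffOn_Ici t₀ t ht)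

theorem hasDerivWithinAt_derivWithin_fst_of_isIntegralCurveOn_phaseField
    (hμ : ContDiffOn ℝ 1 μ (Ici t₀)) (hu : IsIntegralCurveOn u (phaseField t₀ lam μ γ V) (Ici t₀))
    (ht : t ∈ Ici t₀) (hVu : DifferentiableWithinAt ℝ (fun s => V (u s).1) (Ici t₀) t) :
    HasDerivWithinAt (derivWithin (fun s => (u s).1) (Ici t₀))
      (-(lam • derivWithin (fun s => (u s).1) (Ici t₀) t
        + μ t • derivWithin (fun s => V (u s).1) (Ici t₀) t + γ t • V (u t).1)) (Ici t₀) t := by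
  have hvel := eqOn_derivWithin_fst_of_isIntegralCurveOn_phaseField hu
  have hμt := (hμ.differentiableOn one_ne_zero t ht).hasDerivWithinAt
  have hw := (hasDerivWithinAt_fst_and_snd_of_isIntegralCurveOn_phaseField hu ht).2
  have hacc := hw.sub (hμt.smul hVu.hasDerivWithinAt)
  refine (hacc.congr hvel (hvel ht)).congr_deriv ?_
  rw [hvel ht, phaseField]
  module

theorem ae_differentiableAt_lipschitzWith_comp_of_contDiffOn_Ici {F : Type*}
    [NormedAddCommGroup F] [NormedSpace ℝ F] [UniformConvexSpace F] [CompleteSpace F] {W : E → F}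
    (hW : LipschitzWith L W) (hy : ContDiffOn ℝ 1 y (Ici t₀)) :
    ∀ᵐ t ∂volume.restrict (Ici t₀), DifferentiableAt ℝ (fun s => W (y s)) t := by
  refine ae_restrict_Ici_differentiableAt_of_locallyLipschitzOn fun t ht => ?_
  obtain ⟨C, s, hs, hC⟩ := hy.locallyLipschitzOn (convex_Ici t₀) ht
  exact ⟨L * C, s, hs, hW.comp_lipschitzOnWith hC⟩

theorem isStrongGlobalSolution_fst_of_isIntegralCurveOn_phaseField [UniformConvexSpace E]
    [CompleteSpace E] (hμ : ContDiffOn ℝ 1 μ (Ici t₀)) (hγ : ContinuousOn γ (Ici t₀))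
    (hV : LipschitzWith L V) (hu : IsIntegralCurveOn u (phaseField t₀ lam μ γ V) (Ici t₀))
    (hu₀ : u t₀ = (y₀, y₁ + μ t₀ • V y₀)) :
    IsStrongGlobalSolution t₀ lam μ γ V y₀ y₁ fun t => (u t).1 := by
  have hvel := eqOn_derivWithin_fst_of_isIntegralCurveOn_phaseField hu
  have hfield : ContinuousOn (uncurry (phaseField t₀ lam μ γ V)) (Ici t₀ ×ˢ univ) :=
    continuousOn_phaseField hμ hγ hV.continuous
  have hC1 : ContDiffOn ℝ 1 u (Ici t₀) := contDiffOn_one_of_isIntegralCurveOn_Ici hfield hu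
  have hAC : LocallyAbsolutelyContinuousFrom (fun t => (u t).1) t₀ := .of_contDiffOn hC1.fst
  have hACvel : LocallyAbsolutelyContinuousFrom (fun t => (u t).2 - μ t • V (u t).1) t₀ :=
    .sub (.of_contDiffOn hC1.snd) (.smul (.of_contDiffOn hμ) (.lipschitzWith_comp hV hAC))
  have hy₁ : derivWithin (fun t => (u t).1) (Ici t₀) t₀ = y₁ := by
    simp only [hvel self_mem_Ici, hu₀, add_sub_cancel_right]
  refine ⟨hAC, hC1.fst.differentiableOn one_ne_zero, hACvel.congr hvel, ?_, by rw [hu₀], hy₁⟩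
  filter_upwards [ae_differentiableAt_lipschitzWith_comp_of_contDiffOn_Ici hV hC1.fst,
    ae_restrict_mem measurableSet_Ici] with t hVu ht
  have hacc := hasDerivWithinAt_derivWithin_fst_of_isIntegralCurveOn_phaseField hμ hu ht
    hVu.differentiableWithinAt
  refine ⟨hacc.differentiableWithinAt, hVu.differentiableWithinAt, ?_⟩
  rw [hacc.derivWithin (uniqueDiffOn_Ici t₀ t ht)]
  module

end PhaseSpace

theorem theorem4p1_general {E : Type*} [NormedAddCommGroup E] [NormedSpace ℝ E]
    [UniformConvexSpace E] [CompleteSpace E] (t₀ lam : ℝ)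
    {μ : ℝ → ℝ} (hμ : ContDiffOn ℝ 1 μ (Ici t₀)) {γ : ℝ → ℝ} (hγ : ContinuousOn γ (Ici t₀))
    {V : E → E} {L : ℝ≥0} (hV : LipschitzWith L V) (y₀ y₁ : E) :
    ∃ y : ℝ → E, IsStrongGlobalSolution t₀ lam μ γ V y₀ y₁ y ∧
      ∀ z : ℝ → E, IsStrongGlobalSolution t₀ lam μ γ V y₀ y₁ z → EqOn z y (Ici t₀) := by
  obtain ⟨k, hk, hlip⟩ := exists_continuousOn_lipschitzWith_phaseField (lam := lam) hμ hγ hV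
  have hfield : ContinuousOn (uncurry (phaseField t₀ lam μ γ V)) (Ici t₀ ×ˢ univ) :=
    continuousOn_phaseField hμ hγ hV.continuous
  obtain ⟨u, hu₀, hu⟩ := exists_isIntegralCurveOn_Ici_of_lipschitzWith hfield hk
    (fun t _ => hlip t) (y₀, y₁ + μ t₀ • V y₀)
  refine ⟨fun t => (u t).1,
    isStrongGlobalSolution_fst_of_isIntegralCurveOn_phaseField hμ hγ hV hu hu₀, fun z hz t ht => ?_⟩
  have hzu : EqOn (fun t => (z t, momentum t₀ μ V z t)) u (Ici t₀) :=
    eqOn_Ici_of_isIntegralCurveOn_of_lipschitzWith hk (fun t _ => hlip t)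
      (hz.isIntegralCurveOn_phaseField hμ hγ hV) hu
      (by rw [hu₀, momentum, hz.initial_pos, hz.initial_vel])
  exact congrArg Prod.fst (hzu ht)

theorem theorem4p1 {H : Type*} [NormedAddCommGroup H] [InnerProductSpace ℝ H] [CompleteSpace H]
    (t₀ : ℝ) (ht₀ : 0 ≤ t₀) (lam : ℝ) (hlam : 0 < lam)
    (μ : ℝ → ℝ) (hμ_pos : ∀ t ∈ Set.Ici t₀, 0 < μ t) (hμ_C1 : ContDiffOn ℝ 1 μ (Set.Ici t₀))
    (hμ_mono : MonotoneOn μ (Set.Ici t₀))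
    (γ : ℝ → ℝ) (hγ_pos : ∀ t ∈ Set.Ici t₀, 0 < γ t) (hγ_cont : ContinuousOn γ (Set.Ici t₀))
    (V : H → H) (L : ℝ≥0) (hV : LipschitzWith L V)
    (y₀ y₁ : H) :
    ∃ y : ℝ → H, IsStrongGlobalSolution t₀ lam μ γ V y₀ y₁ y ∧
      ∀ z : ℝ → H, IsStrongGlobalSolution t₀ lam μ γ V y₀ y₁ z → Set.EqOn z y (Set.Ici t₀) :=
  theorem4p1_general t₀ lam hμ_C1 hγ_cont hV y₀ y₁
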